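/- Let $0<p\le 1/2$ and $\alpha>1$. Let $P$ be a probability measure under which, for every block length $n\ge1$, the binary channel with hidden-Markov erasures $$Y_t=(a_tX_t)\oplus N_t,\qquad t=1,\dots,n,$$ is used with a (deterministic or random) codebook $\mathcal C_n=(x_0,\dots,x_{M_n-1})$ of $M_n\ge 1$ words in $\{0,1\}^n$. The message $m$ is uniform on $\{0,\dots,M_n-1\}$ and independent of $\mathcal C_n$, and $X^n=x_m$. The noise $(N_t)$ is i.i.d. on $\{0,1\}$ with $P(N_t=1)=p$. The erasures are $a_t=f(A_t)$, where $f:\{1,\dots,d\}\to\{0,1\}$ and $(A_t)$ is a stationary Markov chain on $\{1,\dots,d\}$ with irreducible transition matrix $\Pi=(\pi(i,j))$. The objects $(\mathcal C_n,m)$, $(A_t)$ and $(N_t)$ are mutually independent. Let $Q$ be a probability measure under which $Y_t=X_t\oplus\tilde N_t$ where, for each $n$, the joint law of $(\mathcal C_n,m)$, $(a_1,\dots,a_n)$ and $(\tilde N_1,\dots,\tilde N_n)$ under $Q$ is that of $(\mathcal C_n,m)$, $(a_1,\dots,a_n)$ and $(N_1,\dots,N_n)$ under $P$. The decoder outputs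 $\hat m\in\operatorname{argmin}_k\sum_{t=1}^n \mathsf d(x_{k,t},Y_t)$ for a fixed $\mathsf d:\{0,1\}^2\to[0,\infty)$, ties being broken by an arbitrary deterministic rule. Let $\mathcal E_n=\{\hat m\ne m\}$, and for $\hat P\in\{P,Q\}$ put $$E_*(\hat P)=-\limsup_{n\to\infty}\tfrac1n\ln\hat P(\mathcal E_n),\qquad E^*(\hat P)=-\liminf_{n\to\infty}\tfrac1n\ln\hat P(\mathcal E_n)\qquad(\ln 0=-\infty);$$ the common value is written $E(\hat P)$ when the limit exists. For $\lambda\in\mathbb R$ let $\Pi_\lambda=\big(\pi(i,j)e^{\lambda(1-f(j))}\big)_{i,j}$, let $\rho(\Pi_\lambda)>0$ be its Perron root (its spectral radius), and let $I(x)=\sup_{\lambda\in\mathbb R}\{\lambda x-\ln\rho(\Pi_\lambda)\}\in[0,\infty]$ for $x\in\mathbb R$. Let $\delta(\alpha)=p\big(\tfrac{1-p}{p}\big)^\alpha+(1-p)\big(\tfrac{p}{1-p}\big)^\alpha$. Then $$E^*(P)\le\frac{\alpha}{\alpha-1}E^*(Q)+\frac1{\alpha-1}\sup_{x\in\mathbb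 R}\,[x\ln\delta(\alpha)-I(x)],$$ $$E_*(P)\ge\frac{\alpha-1}{\alpha}E_*(Q)-\frac1{\alpha}\sup_{x\in\mathbb R}\,[x\ln\delta(\alpha)-I(x)].$$ In particular, whenever the limits exist, both bounds hold with $E(P)$ and $E(Q)$. -/

import Mathlib

open MeasureTheory ProbabilityTheory Filter
open scoped ENNReal

/-- Binary words of length `n`. Addition and multiplication in `ZMod 2` are the operations
`⊕` (addition modulo 2) and the product on `{0, 1}`. -/
abbrev Word (n : ℕ) : Type := Fin n → ZMod 2

/-- A codebook with `M` binary codewords of block length `n`. -/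
abbrev Codebook (M n : ℕ) : Type := Fin M → Word n

/-- The additive decoding metric `d_n(x, y) = ∑ d(x_i, y_i)`. -/
def additiveMetric (dm : ZMod 2 → ZMod 2 → ℝ) {n : ℕ} (x y : Word n) : ℝ :=
  ∑ i, dm (x i) (y i)

/-- `ψ` is a metric decoder for `dm`: given the codebook and the channel output, it returns a
minimizer of the decoding metric (how it breaks ties is an arbitrary deterministic rule). -/
def IsMetricDecoder (dm : ZMod 2 → ZMod 2 → ℝ) {M n : ℕ}
    (ψ : Codebook M n → Word n → Fin M) : Prop :=
  ∀ (C : Codebook M n) (y : Word n) (k : Fin M),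
    additiveMetric dm (C (ψ C y)) y ≤ additiveMetric dm (C k) y

section Model

variable {Ω : Type*} [MeasurableSpace Ω]

/-- `A` is a stationary Markov chain with transition matrix `PI` under `P`: the elementary
Markov property with transition probabilities `PI`, and a marginal law constant in time. -/
structure IsStationaryMarkovChain (P : Measure Ω) {d : ℕ}
    (PI : Matrix (Fin d) (Fin d) ℝ) (A : ℕ → Ω → Fin d) : Prop where
  measurable : ∀ t, Measurable (A t)
  markov : ∀ (t : ℕ) (i : ℕ → Fin d),
    P.real {ω | ∀ s ≤ t + 1, A s ω = i s}
      = P.real {ω | ∀ s ≤ t, A s ω = i s} * PI (i t) (i (t + 1))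
  stationary : ∀ t, P.map (A t) = P.map (A 0)

/-- The noise: i.i.d. binary variables with `P (N t = 1) = p`. -/
structure IsBernoulliNoise (P : Measure Ω) (p : ℝ) (N : ℕ → Ω → ZMod 2) : Prop where
  measurable : ∀ t, Measurable (N t)
  indep : iIndepFun N P
  prob_one : ∀ t, P.real {ω | N t ω = 1} = p

/-- The transmitted word: the codeword of the message in the codebook. -/
def codeword {M : ℕ → ℕ} (cb : ∀ n, Ω → Codebook (M n) n) (msg : ∀ n, Ω → Fin (M n))
    (n : ℕ) (ω : Ω) : Word n :=
  cb n ω (msg n ω)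

/-- The binary channel with hidden-Markov erasures, under the measure `P`.
The time `t = 1, …, n` of a block of length `n` is indexed by `Fin n`, that is from `0`.
Deterministic coding is the case where every `cb n` is a constant function. -/
structure IsErasureChannel (P : Measure Ω) (p : ℝ) {d : ℕ}
    (PI : Matrix (Fin d) (Fin d) ℝ) (f : Fin d → ZMod 2) {M : ℕ → ℕ}
    (cb : ∀ n, Ω → Codebook (M n) n) (msg : ∀ n, Ω → Fin (M n))
    (A : ℕ → Ω → Fin d) (N : ℕ → Ω → ZMod 2) (Y : ∀ n, Ω → Word n) : Prop where
  measurable_cb : ∀ n, Measurable (cb n)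
  measurable_msg : ∀ n, Measurable (msg n)
  /-- the message is uniform, and independent of the codebook -/
  msg_uniform : ∀ n k, P.real {ω | msg n ω = k} = 1 / (M n : ℝ)
  msg_indep : ∀ n, IndepFun (cb n) (msg n) P
  chain : IsStationaryMarkovChain P PI A
  noise : IsBernoulliNoise P p N
  /-- the input, the chain and the noise are mutually independent -/
  indep_input : ∀ n, IndepFun (fun ω => (cb n ω, msg n ω))
    (fun ω => ((fun t => A t ω), (fun t => N t ω))) P
  indep_chain_noise : IndepFun (fun ω t => A t ω) (fun ω t => N t ω) P
  /-- `Y_t = (a_t X_t) ⊕ N_t` with `a_t = f (A_t)` -/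
  output : ∀ n, ∀ᵐ ω ∂P, ∀ t : Fin n,
    Y n ω t = f (A t ω) * codeword cb msg n ω t + N t ω

/-- The reference channel without erasures, under the measure `Q`: for every block length,
the input, the erasures and the noise `N'` have under `Q` the joint law which the input,
the erasures and the noise `N` have under `P`, and `Y_t = X_t ⊕ N'_t`. -/
structure IsReferenceChannel (P Q : Measure Ω) {d : ℕ} (f : Fin d → ZMod 2) {M : ℕ → ℕ}
    (cb : ∀ n, Ω → Codebook (M n) n) (msg : ∀ n, Ω → Fin (M n))
    (A : ℕ → Ω → Fin d) (N N' : ℕ → Ω → ZMod 2) (Y : ∀ n, Ω → Word n) : Prop where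
  same_law : ∀ n : ℕ, IdentDistrib
    (fun ω => ((cb n ω, msg n ω), (fun t : Fin n => f (A t ω)), (fun t : Fin n => N' t ω)))
    (fun ω => ((cb n ω, msg n ω), (fun t : Fin n => f (A t ω)), (fun t : Fin n => N t ω)))
    Q P
  output : ∀ n, ∀ᵐ ω ∂Q, ∀ t : Fin n, Y n ω t = codeword cb msg n ω t + N' t ω

/-- The error event: the decoded message differs from the transmitted one. -/
def errorEvent {M : ℕ → ℕ} (ψ : ∀ n, Codebook (M n) n → Word n → Fin (M n))
    (cb : ∀ n, Ω → Codebook (M n) n) (msg : ∀ n, Ω → Fin (M n)) (Y : ∀ n, Ω → Word n)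
    (n : ℕ) : Set Ω :=
  {ω | ψ n (cb n ω) (Y n ω) ≠ msg n ω}

/-- `E_* = - limsup (1/n) ln P(E_n)`, with `ln 0 = -∞`. -/
noncomputable def lowerExponent (P : Measure Ω) (E : ℕ → Set Ω) : EReal :=
  - limsup (fun n : ℕ => ((1 / (n : ℝ) : ℝ) : EReal) * ENNReal.log (P (E n))) atTop

/-- `E^* = - liminf (1/n) ln P(E_n)`, with `ln 0 = -∞`. -/
noncomputable def upperExponent (P : Measure Ω) (E : ℕ → Set Ω) : EReal :=
  - liminf (fun n : ℕ => ((1 / (n : ℝ) : ℝ) : EReal) * ENNReal.log (P (E n))) atTop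

end Model

/-- The tilted matrix `π(i, j) exp (l * (1 - f j))`. -/
noncomputable def tiltedMatrix {d : ℕ} (PI : Matrix (Fin d) (Fin d) ℝ) (f : Fin d → ZMod 2)
    (l : ℝ) : Matrix (Fin d) (Fin d) ℝ :=
  fun i j => PI i j * Real.exp (l * (if f j = 0 then 1 else 0))

/-- The Perron root of a nonnegative irreducible matrix: its spectral radius, that is the
largest modulus of a complex eigenvalue. -/
noncomputable def perronRoot {d : ℕ} (B : Matrix (Fin d) (Fin d) ℝ) : ℝ :=
  (spectralRadius ℂ (B.map (fun x => (x : ℂ)))).toReal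

/-- The rate function `I(x) = sup_l (l x - ln ρ(Π_l))`, with values in `[0, ∞]`. -/
noncomputable def markovRate {d : ℕ} (PI : Matrix (Fin d) (Fin d) ℝ) (f : Fin d → ZMod 2)
    (x : ℝ) : EReal :=
  ⨆ l : ℝ, ((l * x - Real.log (perronRoot (tiltedMatrix PI f l)) : ℝ) : EReal)

/-- `δ(α) = p ((1-p)/p)^α + (1-p) (p/(1-p))^α`. -/
noncomputable def erasureDelta (p α : ℝ) : ℝ :=
  p * ((1 - p) / p) ^ α + (1 - p) * (p / (1 - p)) ^ α

/-- `sup_x (x ln δ(α) - I(x))`. -/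
noncomputable def divergenceRate {d : ℕ} (p : ℝ) (PI : Matrix (Fin d) (Fin d) ℝ)
    (f : Fin d → ZMod 2) (α : ℝ) : EReal :=
  ⨆ x : ℝ, (((x * Real.log (erasureDelta p α) : ℝ) : EReal) - markovRate PI f x)

/-! Both channels can be realised under `P`, since the reference channel is the one whose mask `f`
is replaced by the constant 1. A decoding error then says that (input, output) lies in one fixed
set, so the two error probabilities can be compared by Hölder's inequality, in either direction:
P₁(S) ≤ P₂(S)^((α-1)/α) · (∑ P₁^α P₂^(1-α))^(1/α).

Given the input and the chain, the Rényi moment factors over time. A letter contributes 1 unless it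
is erased, and at most δ(α) ≥ 1 if it is. So the moment is at most E[δ(α)^(number of erasures)],
which the Markov property turns into powers of the tilted matrix at l = ln δ(α)
(`IsStationaryMarkovChain.sum_path_le`). By Gelfand's formula it grows at rate at most ln ρ(Π_l)
(`tendsto_log_powEntrySum`).

Finally ln ρ(Π_l) is convex in l, so it equals its biconjugate, the supremum in the theorem
(`divergenceRate_eq`). -/

/-- The sum of all entries of `B ^ n`. -/
noncomputable def powEntrySum {d : ℕ} (B : Matrix (Fin d) (Fin d) ℝ) (n : ℕ) : ℝ :=
  ∑ i, (B ^ n).mulVec 1 i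

/-- Hölder with exponents 1/a and 1/b. It serves both the convexity of the log Perron root and the
change of measure. -/
lemma sum_rpow_mul_rpow_le {ι : Type*} (s : Finset ι) {f g : ι → ℝ} (hf : ∀ i ∈ s, 0 ≤ f i)
    (hg : ∀ i ∈ s, 0 ≤ g i) {a b : ℝ} (ha : 0 < a) (hb : 0 < b) (hab : a + b = 1) :
    ∑ i ∈ s, f i ^ a * g i ^ b ≤ (∑ i ∈ s, f i) ^ a * (∑ i ∈ s, g i) ^ b := by
  have hpq : (1 / a).HolderConjugate (1 / b) := by
    rw [Real.holderConjugate_iff]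
    refine ⟨?_, by simpa using hab⟩
    rw [lt_div_iff₀ ha]; linarith
  have h := Real.inner_le_Lp_mul_Lq_of_nonneg s (f := fun i => f i ^ a) (g := fun i => g i ^ b) hpq
    (fun i hi => Real.rpow_nonneg (hf i hi) _) (fun i hi => Real.rpow_nonneg (hg i hi) _)
  have h1 : ∑ i ∈ s, (f i ^ a) ^ (1 / a) = ∑ i ∈ s, f i := Finset.sum_congr rfl fun i hi => by
    rw [← Real.rpow_mul (hf i hi), mul_one_div_cancel ha.ne', Real.rpow_one]
  have h2 : ∑ i ∈ s, (g i ^ b) ^ (1 / b) = ∑ i ∈ s, g i := Finset.sum_congr rfl fun i hi => by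
    rw [← Real.rpow_mul (hg i hi), mul_one_div_cancel hb.ne', Real.rpow_one]
  simpa only [h1, h2, one_div_one_div] using h

/-! ### Growth of powers of a nonnegative matrix -/

section PowEntrySum

variable {d : ℕ} {B : Matrix (Fin d) (Fin d) ℝ}

lemma Matrix.pow_nonneg_entry (hB : ∀ i j, 0 ≤ B i j) (n : ℕ) (i j : Fin d) : 0 ≤ (B ^ n) i j := by
  induction n generalizing i j with
  | zero => simp only [pow_zero, Matrix.one_apply]; split_ifs <;> norm_num
  | succ n ih =>
    rw [pow_succ, Matrix.mul_apply]
    exact Finset.sum_nonneg fun k _ => mul_nonneg (ih i k) (hB k j)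

lemma pow_mulVec_one_nonneg (hB : ∀ i j, 0 ≤ B i j) (n : ℕ) (i : Fin d) :
    0 ≤ (B ^ n).mulVec 1 i := by
  simp only [Matrix.mulVec, dotProduct, Pi.one_apply, mul_one]
  exact Finset.sum_nonneg fun j _ => Matrix.pow_nonneg_entry hB n i j

lemma pow_succ_mulVec_one (n : ℕ) (i : Fin d) :
    (B ^ (n + 1)).mulVec 1 i = ∑ j, B i j * (B ^ n).mulVec 1 j := by
  rw [pow_succ', ← Matrix.mulVec_mulVec]; rfl

lemma pow_mulVec_one_le_powEntrySum (hB : ∀ i j, 0 ≤ B i j) (n : ℕ) (i : Fin d) :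
    (B ^ n).mulVec 1 i ≤ powEntrySum B n :=
  Finset.single_le_sum (f := fun i => (B ^ n).mulVec 1 i)
    (fun i _ => pow_mulVec_one_nonneg hB n i) (Finset.mem_univ i)

lemma pow_le_pow_mulVec_one {c : ℝ} (hc : 0 ≤ c) (hB : ∀ i j, 0 ≤ B i j)
    (hrow : ∀ i, c ≤ ∑ j, B i j) (n : ℕ) (i : Fin d) : c ^ n ≤ (B ^ n).mulVec 1 i := by
  induction n generalizing i with
  | zero => simp
  | succ n ih =>
    rw [pow_succ_mulVec_one]
    calc c ^ (n + 1) = c * c ^ n := pow_succ' c n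
      _ ≤ (∑ j, B i j) * c ^ n := by gcongr; exact hrow i
      _ = ∑ j, B i j * c ^ n := Finset.sum_mul ..
      _ ≤ _ := Finset.sum_le_sum fun j _ => mul_le_mul_of_nonneg_left (ih j) (hB i j)

lemma pow_le_powEntrySum (hd : 0 < d) {c : ℝ} (hc : 0 ≤ c) (hB : ∀ i j, 0 ≤ B i j)
    (hrow : ∀ i, c ≤ ∑ j, B i j) (n : ℕ) : c ^ n ≤ powEntrySum B n :=
  (pow_le_pow_mulVec_one hc hB hrow n ⟨0, hd⟩).trans (pow_mulVec_one_le_powEntrySum hB n _)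

attribute [local instance] Matrix.linftyOpNormedRing Matrix.linftyOpNormedAlgebra

/-- For a nonnegative matrix the ℓ∞ operator norm is the largest row sum, and there are `d` rows. -/
lemma norm_pow_le_powEntrySum (hB : ∀ i j, 0 ≤ B i j) (n : ℕ) :
    ‖(B.map (fun x => (x : ℂ))) ^ n‖ ≤ powEntrySum B n ∧
      powEntrySum B n ≤ d * ‖(B.map (fun x => (x : ℂ))) ^ n‖ := by
  have hmap : (B.map (fun x => (x : ℂ))) ^ n = (B ^ n).map (fun x => (x : ℂ)) :=
    (Matrix.map_pow B Complex.ofRealHom n).symm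
  have hrow : ∀ i, ((∑ j, ‖((B ^ n).map (fun x => (x : ℂ))) i j‖₊ : NNReal) : ℝ)
      = (B ^ n).mulVec 1 i := fun i => by
    simp only [Matrix.mulVec, dotProduct, Pi.one_apply, mul_one, Matrix.map_apply, NNReal.coe_sum,
      coe_nnnorm, Complex.norm_real, Real.norm_eq_abs]
    exact Finset.sum_congr rfl fun j _ => abs_of_nonneg (Matrix.pow_nonneg_entry hB n i j)
  rw [hmap, Matrix.linfty_opNorm_def]
  constructor
  · have h0 : 0 ≤ powEntrySum B n := Finset.sum_nonneg fun i _ => pow_mulVec_one_nonneg hB n i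
    rw [← Real.coe_toNNReal _ h0, NNReal.coe_le_coe]
    refine Finset.sup_le fun i _ => ?_
    rw [← NNReal.coe_le_coe, hrow, Real.coe_toNNReal _ h0]
    exact pow_mulVec_one_le_powEntrySum hB n i
  · have hle : ∀ i : Fin d, (B ^ n).mulVec 1 i ≤ ((Finset.univ.sup fun i : Fin d =>
        ∑ j, ‖((B ^ n).map (fun x => (x : ℂ))) i j‖₊ : NNReal) : ℝ) := fun i => by
      rw [← hrow i]
      exact NNReal.coe_le_coe.2 (Finset.le_sup
        (f := fun i => ∑ j, ‖((B ^ n).map (fun x => (x : ℂ))) i j‖₊) (Finset.mem_univ i))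
    exact (Finset.sum_le_card_nsmul Finset.univ _ _ fun i _ => hle i).trans_eq (by simp)

/-- Gelfand's formula: the entry sum is the norm up to a factor between 1 and `d`, and d^(1/n) → 1.
-/
lemma tendsto_powEntrySum_rpow (hd : 0 < d) (hB : ∀ i j, 0 ≤ B i j) :
    Tendsto (fun n : ℕ => powEntrySum B n ^ (1 / n : ℝ)) atTop (nhds (perronRoot B)) := by
  set a : Matrix (Fin d) (Fin d) ℂ := B.map (fun x => (x : ℂ)) with ha
  have hG := spectrum.pow_norm_pow_one_div_tendsto_nhds_spectralRadius a
  have hfin : spectralRadius ℂ a ≠ ∞ := by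
    refine ne_top_of_le_ne_top (ENNReal.ofReal_ne_top (r := ‖a‖)) (le_of_tendsto hG ?_)
    filter_upwards [eventually_gt_atTop 0] with n hn
    apply ENNReal.ofReal_le_ofReal
    calc ‖a ^ n‖ ^ (1 / n : ℝ) ≤ (‖a‖ ^ n) ^ (1 / n : ℝ) := by
          gcongr; exact norm_pow_le' a hn
      _ = ‖a‖ := by
          rw [one_div, Real.pow_rpow_inv_natCast (norm_nonneg _) hn.ne']
  have hN : Tendsto (fun n : ℕ => ‖a ^ n‖ ^ (1 / n : ℝ)) atTop (nhds (perronRoot B)) := by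
    refine ((ENNReal.tendsto_toReal hfin).comp hG).congr fun n => ?_
    exact ENNReal.toReal_ofReal (by positivity)
  have hD : Tendsto (fun n : ℕ => (d : ℝ) ^ (1 / n : ℝ)) atTop (nhds 1) := by
    have := tendsto_const_nhds (x := (d : ℝ)) (f := atTop (α := ℕ)) |>.rpow
      (tendsto_one_div_atTop_nhds_zero_nat (𝕜 := ℝ)) (Or.inl (by positivity))
    simpa using this
  have hU := hD.mul hN
  rw [one_mul] at hU
  refine tendsto_of_tendsto_of_tendsto_of_le_of_le hN hU (fun n => ?_) (fun n => ?_)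
  · exact Real.rpow_le_rpow (norm_nonneg _) (norm_pow_le_powEntrySum hB n).1 (by positivity)
  · rw [← Real.mul_rpow (by positivity) (norm_nonneg _)]
    exact Real.rpow_le_rpow (Finset.sum_nonneg fun i _ => pow_mulVec_one_nonneg hB n i)
      (norm_pow_le_powEntrySum hB n).2 (by positivity)

lemma le_perronRoot (hd : 0 < d) {c : ℝ} (hc : 0 ≤ c) (hB : ∀ i j, 0 ≤ B i j)
    (hrow : ∀ i, c ≤ ∑ j, B i j) : c ≤ perronRoot B := by
  refine ge_of_tendsto (tendsto_powEntrySum_rpow hd hB) ?_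
  filter_upwards [eventually_gt_atTop 0] with n hn
  calc c = (c ^ n) ^ (1 / n : ℝ) := by rw [one_div, Real.pow_rpow_inv_natCast hc hn.ne']
    _ ≤ _ := Real.rpow_le_rpow (by positivity) (pow_le_powEntrySum hd hc hB hrow n) (by positivity)

lemma tendsto_log_powEntrySum (hd : 0 < d) {c : ℝ} (hc : 0 < c) (hB : ∀ i j, 0 ≤ B i j)
    (hrow : ∀ i, c ≤ ∑ j, B i j) :
    Tendsto (fun n : ℕ => 1 / (n : ℝ) * Real.log (powEntrySum B n)) atTop
      (nhds (Real.log (perronRoot B))) := by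
  refine ((tendsto_powEntrySum_rpow hd hB).log
    (hc.trans_le (le_perronRoot hd hc.le hB hrow)).ne').congr fun n => ?_
  exact Real.log_rpow ((pow_pos hc n).trans_le (pow_le_powEntrySum hd hc.le hB hrow n)) _

end PowEntrySum

/-! ### Convexity and biconjugation of the log Perron root -/

section Tilted

variable {d : ℕ} {PI : Matrix (Fin d) (Fin d) ℝ} {f : Fin d → ZMod 2}

lemma tiltedMatrix_nonneg (h0 : ∀ i j, 0 ≤ PI i j) (l : ℝ) (i j : Fin d) :
    0 ≤ tiltedMatrix PI f l i j :=
  mul_nonneg (h0 i j) (Real.exp_pos _).le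

/-- A positive lower bound on the row sums keeps entry sums and Perron root positive, so that their
logarithms are genuine. -/
lemma min_one_exp_le_sum_tiltedMatrix (h0 : ∀ i j, 0 ≤ PI i j) (h1 : ∀ i, ∑ j, PI i j = 1)
    (l : ℝ) (i : Fin d) : min 1 (Real.exp l) ≤ ∑ j, tiltedMatrix PI f l i j := by
  calc min 1 (Real.exp l) = ∑ j, PI i j * min 1 (Real.exp l) := by
        rw [← Finset.sum_mul, h1, one_mul]
    _ ≤ _ := Finset.sum_le_sum fun j _ => mul_le_mul_of_nonneg_left (by
        split_ifs <;> simp) (h0 i j)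

lemma tendsto_log_powEntrySum_tiltedMatrix (hd : 0 < d) (h0 : ∀ i j, 0 ≤ PI i j)
    (h1 : ∀ i, ∑ j, PI i j = 1) (l : ℝ) :
    Tendsto (fun n : ℕ => 1 / (n : ℝ) * Real.log (powEntrySum (tiltedMatrix PI f l) n)) atTop
      (nhds (Real.log (perronRoot (tiltedMatrix PI f l)))) :=
  tendsto_log_powEntrySum hd (lt_min one_pos (Real.exp_pos l)) (tiltedMatrix_nonneg h0 l)
    (min_one_exp_le_sum_tiltedMatrix h0 h1 l)

lemma powEntrySum_tiltedMatrix_pos (hd : 0 < d) (h0 : ∀ i j, 0 ≤ PI i j)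
    (h1 : ∀ i, ∑ j, PI i j = 1) (l : ℝ) (n : ℕ) :
    0 < powEntrySum (tiltedMatrix PI f l) n :=
  (pow_pos (lt_min one_pos (Real.exp_pos l)) n).trans_le
    (pow_le_powEntrySum hd (lt_min one_pos (Real.exp_pos l)).le (tiltedMatrix_nonneg h0 l)
      (min_one_exp_le_sum_tiltedMatrix h0 h1 l) n)

lemma tiltedMatrix_convex_comb (h0 : ∀ i j, 0 ≤ PI i j) {a b : ℝ}
    (hab : a + b = 1) (x y : ℝ) (i j : Fin d) :
    tiltedMatrix PI f (a * x + b * y) i j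
      = tiltedMatrix PI f x i j ^ a * tiltedMatrix PI f y i j ^ b := by
  simp only [tiltedMatrix]
  generalize (if f j = 0 then (1 : ℝ) else 0) = u
  rw [Real.mul_rpow (h0 i j) (Real.exp_pos _).le, Real.mul_rpow (h0 i j) (Real.exp_pos _).le,
    ← Real.exp_mul, ← Real.exp_mul, mul_mul_mul_comm, ← Real.exp_add,
    ← Real.rpow_add' (h0 i j) (by rw [hab]; exact one_ne_zero), hab, Real.rpow_one]
  ring_nf

/-- Each entry of the tilted matrix is log-affine in the parameter, and Hölder carries log-convexity
through each matrix product. -/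
lemma pow_tiltedMatrix_mulVec_one_le (h0 : ∀ i j, 0 ≤ PI i j) {a b : ℝ} (ha : 0 < a) (hb : 0 < b)
    (hab : a + b = 1) (x y : ℝ) (n : ℕ) (i : Fin d) :
    (tiltedMatrix PI f (a * x + b * y) ^ n).mulVec 1 i
      ≤ (tiltedMatrix PI f x ^ n).mulVec 1 i ^ a * (tiltedMatrix PI f y ^ n).mulVec 1 i ^ b := by
  have hx := tiltedMatrix_nonneg (f := f) h0 x
  have hy := tiltedMatrix_nonneg (f := f) h0 y
  induction n generalizing i with
  | zero => simp
  | succ n ih =>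
    simp only [pow_succ_mulVec_one]
    calc _ ≤ ∑ j, tiltedMatrix PI f (a * x + b * y) i j *
          ((tiltedMatrix PI f x ^ n).mulVec 1 j ^ a * (tiltedMatrix PI f y ^ n).mulVec 1 j ^ b) :=
          Finset.sum_le_sum fun j _ => mul_le_mul_of_nonneg_left (ih j) (tiltedMatrix_nonneg h0 _ _ _)
      _ = ∑ j, (tiltedMatrix PI f x i j * (tiltedMatrix PI f x ^ n).mulVec 1 j) ^ a *
            (tiltedMatrix PI f y i j * (tiltedMatrix PI f y ^ n).mulVec 1 j) ^ b :=
          Finset.sum_congr rfl fun j _ => by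
            rw [tiltedMatrix_convex_comb h0 hab,
              Real.mul_rpow (hx i j) (pow_mulVec_one_nonneg hx n j),
              Real.mul_rpow (hy i j) (pow_mulVec_one_nonneg hy n j)]
            ring
      _ ≤ _ := sum_rpow_mul_rpow_le _ (fun j _ => mul_nonneg (hx i j) (pow_mulVec_one_nonneg hx n j))
          (fun j _ => mul_nonneg (hy i j) (pow_mulVec_one_nonneg hy n j)) ha hb hab

lemma convexOn_log_perronRoot_tiltedMatrix (hd : 0 < d) (h0 : ∀ i j, 0 ≤ PI i j)
    (h1 : ∀ i, ∑ j, PI i j = 1) :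
    ConvexOn ℝ Set.univ (fun l => Real.log (perronRoot (tiltedMatrix PI f l))) := by
  refine convexOn_iff_forall_pos.2 ⟨convex_univ, fun x _ y _ a b ha hb hab => ?_⟩
  have hT := tendsto_log_powEntrySum_tiltedMatrix (f := f) hd h0 h1
  refine le_of_tendsto_of_tendsto' (hT _) (((hT x).const_mul a).add ((hT y).const_mul b))
    fun n => ?_
  have hp := powEntrySum_tiltedMatrix_pos (f := f) hd h0 h1
  have key : powEntrySum (tiltedMatrix PI f (a * x + b * y)) n
      ≤ powEntrySum (tiltedMatrix PI f x) n ^ a * powEntrySum (tiltedMatrix PI f y) n ^ b :=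
    (Finset.sum_le_sum fun i _ => pow_tiltedMatrix_mulVec_one_le h0 ha hb hab x y n i).trans
      (sum_rpow_mul_rpow_le _
        (fun i _ => pow_mulVec_one_nonneg (tiltedMatrix_nonneg h0 x) n i)
        (fun i _ => pow_mulVec_one_nonneg (tiltedMatrix_nonneg h0 y) n i) ha hb hab)
  have hlog := Real.log_le_log (hp _ n) key
  rw [Real.log_mul (Real.rpow_pos_of_pos (hp x n) a).ne' (Real.rpow_pos_of_pos (hp y n) b).ne',
    Real.log_rpow (hp x n), Real.log_rpow (hp y n)] at hlog
  have := mul_le_mul_of_nonneg_left hlog (by positivity : 0 ≤ 1 / (n : ℝ))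
  simp only [smul_eq_mul]
  linarith

/-- The biconjugate of `ln ρ(Π_l)`, evaluated at `ln δ(α)`, is `ln ρ(Π_l)` itself. -/
lemma divergenceRate_eq (hd : 0 < d) (h0 : ∀ i j, 0 ≤ PI i j) (h1 : ∀ i, ∑ j, PI i j = 1)
    (p α : ℝ) :
    divergenceRate p PI f α
      = (Real.log (perronRoot (tiltedMatrix PI f (Real.log (erasureDelta p α)))) : EReal) := by
  set l₀ := Real.log (erasureDelta p α) with hl₀
  have hconv := convexOn_log_perronRoot_tiltedMatrix (f := f) hd h0 h1
  unfold divergenceRate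
  rw [← hl₀]
  apply le_antisymm
  -- Fenchel's inequality: the parameter `l₀` is one competitor in the supremum defining the rate.
  · refine iSup_le fun x => ?_
    rw [EReal.sub_le_iff_le_add (Or.inr (EReal.coe_ne_top _)) (Or.inr (EReal.coe_ne_bot _))]
    calc ((x * l₀ : ℝ) : EReal)
        = (Real.log (perronRoot (tiltedMatrix PI f l₀)) : EReal)
          + ((l₀ * x - Real.log (perronRoot (tiltedMatrix PI f l₀)) : ℝ) : EReal) := by
          rw [← EReal.coe_add]; congr 1; ring
      _ ≤ _ := add_le_add le_rfl (le_iSup (fun l : ℝ =>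
          ((l * x - Real.log (perronRoot (tiltedMatrix PI f l)) : ℝ) : EReal)) l₀)
  · refine EReal.ge_of_forall_gt_iff_ge.1 fun a ha => ?_
    have hcont : LowerSemicontinuousOn
        (fun l => Real.log (perronRoot (tiltedMatrix PI f l))) Set.univ :=
      (hconv.continuousOn isOpen_univ).lowerSemicontinuousOn
    -- An affine minorant with value `a` at `l₀`. Its slope `c` is the `x` that nearly attains the
    -- supremum, and its intercept bounds the rate there.
    obtain ⟨c, c', hle, hc⟩ := hconv.exists_affine_le_of_lt_real (Set.mem_univ l₀)
      (EReal.coe_lt_coe_iff.1 ha) isClosed_univ hcont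
    refine le_trans ?_ (le_iSup (fun x : ℝ => ((x * l₀ : ℝ) : EReal) - markovRate PI f x) c)
    have hI : markovRate PI f c ≤ ((-c' : ℝ) : EReal) := iSup_le fun l => by
      have := hle l (Set.mem_univ l)
      exact EReal.coe_le_coe_iff.2 (by linarith)
    calc (a : EReal) = ((c * l₀ : ℝ) : EReal) - ((-c' : ℝ) : EReal) := by
          rw [← EReal.coe_sub, ← hc]; congr 1; ring
      _ ≤ _ := EReal.sub_le_sub le_rfl hI

end Tilted

/-! ### Exponential moments along a Markov path -/

section Chain

variable {Ω : Type*} [MeasurableSpace Ω] {P : Measure Ω} {d : ℕ}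
  {PI : Matrix (Fin d) (Fin d) ℝ} {A : ℕ → Ω → Fin d}

lemma IsStationaryMarkovChain.measureReal_snoc (hA : IsStationaryMarkovChain P PI A) (n : ℕ)
    (i : Fin (n + 1) → Fin d) (j : Fin d) :
    P.real {ω | ∀ s : Fin (n + 2), A s ω = (Fin.snoc i j : Fin (n + 2) → Fin d) s}
      = P.real {ω | ∀ s : Fin (n + 1), A s ω = i s} * PI (i (Fin.last n)) j := by
  have h := hA.markov n (fun s => if h : s < n + 1 then i ⟨s, h⟩ else j)
  have e1 : {ω | ∀ s : Fin (n + 2), A s ω = (Fin.snoc i j : Fin (n + 2) → Fin d) s}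
      = {ω | ∀ s ≤ n + 1, A s ω = if h : s < n + 1 then i ⟨s, h⟩ else j} := by
    ext ω
    simp only [Set.mem_ofPred_eq, Fin.snoc, Fin.forall_iff, Nat.lt_succ_iff]
    rfl
  have e2 : {ω | ∀ s : Fin (n + 1), A s ω = i s}
      = {ω | ∀ s ≤ n, A s ω = if h : s < n + 1 then i ⟨s, h⟩ else j} := by
    ext ω
    simp only [Set.mem_ofPred_eq, Fin.forall_iff, Nat.lt_succ_iff]
    exact forall₂_congr fun s hs => by rw [dif_pos hs]
  rw [e1, e2, h]
  simp [Fin.last]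

/-- Summing out the last state replaces `h` by the weighted matrix applied to `h`. The test function
is kept arbitrary so that the induction closes. -/
lemma IsStationaryMarkovChain.sum_path_eq (hA : IsStationaryMarkovChain P PI A)
    (g : Fin d → ℝ) (n : ℕ) (h : Fin d → ℝ) :
    ∑ i : Fin (n + 1) → Fin d, P.real {ω | ∀ s : Fin (n + 1), A s ω = i s}
        * (∏ s, g (i s)) * h (i (Fin.last n))
      = ∑ j, P.real {ω | A 0 ω = j} * g j *
          ((Matrix.of fun k j => PI k j * g j) ^ n).mulVec h j := by
  induction n generalizing h with
  | zero =>
    rw [← (Equiv.funUnique (Fin 1) (Fin d)).symm.sum_comp]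
    refine Finset.sum_congr rfl fun j _ => ?_
    have : {ω | ∀ s : Fin (0 + 1), A s ω = (Equiv.funUnique (Fin 1) (Fin d)).symm j s}
        = {ω | A 0 ω = j} := by
      ext ω
      simp
    rw [this]
    simp
  | succ n ih =>
    rw [← (Fin.snocEquiv fun _ => Fin d).sum_comp, Fintype.sum_prod_type_right, pow_succ]
    simp only [← Matrix.mulVec_mulVec]
    rw [← ih]
    refine Finset.sum_congr rfl fun i _ => ?_
    simp only [Matrix.mulVec, dotProduct, Matrix.of_apply, Finset.mul_sum]
    refine Finset.sum_congr rfl fun j _ => ?_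
    have := hA.measureReal_snoc n i j
    simp only [Fin.snocEquiv, Equiv.coe_fn_mk]
    rw [this, Fin.prod_univ_castSucc]
    simp only [Fin.snoc_castSucc, Fin.snoc_last]
    ring

/-- A path of `n + 1` states has `n` transitions. The weight of the initial state lies outside the
matrix power and costs at most exp |l|. -/
lemma IsStationaryMarkovChain.sum_path_le [IsProbabilityMeasure P]
    (hA : IsStationaryMarkovChain P PI A) (h0 : ∀ i j, 0 ≤ PI i j) (f : Fin d → ZMod 2)
    (l : ℝ) (n : ℕ) :
    ∑ i : Fin (n + 1) → Fin d, P.real {ω | ∀ s : Fin (n + 1), A s ω = i s}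
        * ∏ s, Real.exp (l * (if f (i s) = 0 then 1 else 0))
      ≤ Real.exp |l| * powEntrySum (tiltedMatrix PI f l) n := by
  have h := hA.sum_path_eq (fun j => Real.exp (l * (if f j = 0 then 1 else 0))) n 1
  simp only [Pi.one_apply, mul_one] at h
  rw [h, powEntrySum, Finset.mul_sum]
  refine Finset.sum_le_sum fun j _ => ?_
  refine mul_le_mul_of_nonneg_right ?_ (pow_mulVec_one_nonneg (tiltedMatrix_nonneg h0 l) n j)
  calc _ ≤ 1 * Real.exp |l| := by
        gcongr
        · exact measureReal_le_one
        · split_ifs <;> simp [le_abs_self]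
    _ = _ := one_mul _

end Chain

/-! ### Passing to exponents in the extended reals -/

section Limits

lemma tendsto_log_mul_shift {S : ℕ → ℝ} (hS : ∀ n, 0 < S n) {C L : ℝ} (hC : 0 < C)
    (h : Tendsto (fun n : ℕ => 1 / (n : ℝ) * Real.log (S n)) atTop (nhds L)) :
    Tendsto (fun n : ℕ => 1 / (n : ℝ) * Real.log (C * S (n - 1))) atTop (nhds L) := by
  rw [← tendsto_add_atTop_iff_nat 1]
  have h1 := (tendsto_natCast_div_add_atTop (1 : ℝ)).mul h
  have h2 := (tendsto_one_div_add_atTop_nhds_zero_nat (𝕜 := ℝ)).mul_const (Real.log C)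
  have h3 := h1.add h2
  rw [one_mul, zero_mul, add_zero] at h3
  refine h3.congr' ?_
  filter_upwards [eventually_gt_atTop 0] with n hn
  have : (n : ℝ) ≠ 0 := by positivity
  rw [Nat.add_sub_cancel, Real.log_mul hC.ne' (hS n).ne']
  push_cast
  field_simp
  ring

variable {u v : ℕ → EReal} {e : ℕ → ℝ} {L β : ℝ}

/-- The correction `e` has a finite limit, so no ∞ - ∞ arises. -/
lemma limsup_le_mul_limsup_add (hβ : 0 < β) (he : Tendsto e atTop (nhds L))
    (h : ∀ᶠ n in atTop, u n ≤ (β : EReal) * v n + e n) :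
    limsup u atTop ≤ (β : EReal) * limsup v atTop + L := by
  have he' : limsup (fun n => (e n : EReal)) atTop = L :=
    (EReal.tendsto_coe.2 he).limsup_eq
  calc limsup u atTop ≤ limsup ((fun n => (β : EReal) * v n) + fun n => (e n : EReal)) atTop :=
        limsup_le_limsup h
    _ ≤ limsup (fun n => (β : EReal) * v n) atTop + limsup (fun n => (e n : EReal)) atTop :=
        EReal.limsup_add_le (Or.inr (by simp [he'])) (Or.inr (by simp [he']))
    _ = _ := by
        rw [he', EReal.limsup_const_mul_of_nonneg_of_ne_top (EReal.coe_nonneg.2 hβ.le)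
          (EReal.coe_ne_top _)]

lemma liminf_le_mul_liminf_add (hβ : 0 < β) (he : Tendsto e atTop (nhds L))
    (h : ∀ᶠ n in atTop, u n ≤ (β : EReal) * v n + e n) :
    liminf u atTop ≤ (β : EReal) * liminf v atTop + L := by
  have he' : limsup (fun n => (e n : EReal)) atTop = L :=
    (EReal.tendsto_coe.2 he).limsup_eq
  calc liminf u atTop ≤ liminf ((fun n => (e n : EReal)) + fun n => (β : EReal) * v n) atTop :=
        liminf_le_liminf (h.mono fun n hn => by rwa [Pi.add_apply, add_comm])
    _ ≤ limsup (fun n => (e n : EReal)) atTop + liminf (fun n => (β : EReal) * v n) atTop :=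
        EReal.liminf_add_le (Or.inl (by simp [he'])) (Or.inl (by simp [he']))
    _ = _ := by
        rw [he', EReal.liminf_const_mul_of_nonneg_of_ne_top (EReal.coe_nonneg.2 hβ.le)
          (EReal.coe_ne_top _), add_comm]

/-- Solves the hypothesis for `-x`. The infinite values, which occur when error probabilities
vanish, are treated separately. -/
lemma neg_le_of_le_mul_add {x y : EReal} {α L : ℝ} (hα : 1 < α)
    (h : y ≤ (((α - 1) / α : ℝ) : EReal) * x + ((1 / α * L : ℝ) : EReal)) :
    -x ≤ ((α / (α - 1) : ℝ) : EReal) * (-y) + ((1 / (α - 1) : ℝ) : EReal) * (L : EReal) := by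
  have h1 : 0 < α - 1 := by linarith
  have h2 : 0 < α := by linarith
  have hβ : 0 < (α - 1) / α := div_pos h1 h2
  have hγ : 0 < α / (α - 1) := div_pos h2 h1
  induction x with
  | top => simp
  | bot =>
    rw [EReal.coe_mul_bot_of_pos hβ, EReal.bot_add, le_bot_iff] at h
    rw [h, EReal.neg_bot, EReal.coe_mul_top_of_pos hγ, ← EReal.coe_mul, EReal.top_add_coe]
  | coe x =>
    induction y with
    | top =>
      rw [← EReal.coe_mul, ← EReal.coe_add] at h
      exact absurd (top_le_iff.1 h) (EReal.coe_ne_top _)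
    | bot =>
      rw [EReal.neg_bot, EReal.coe_mul_top_of_pos hγ, ← EReal.coe_mul, EReal.top_add_coe]
      exact le_top
    | coe y =>
      norm_cast at h ⊢
      have h3 := mul_le_mul_of_nonneg_left h hγ.le
      have h4 : α / (α - 1) * ((α - 1) / α * x + 1 / α * L) = x + 1 / (α - 1) * L := by
        field_simp
      linarith

lemma mul_neg_sub_le_neg {x y : EReal} {α L : ℝ}
    (h : x ≤ (((α - 1) / α : ℝ) : EReal) * y + ((1 / α * L : ℝ) : EReal)) :
    (((α - 1) / α : ℝ) : EReal) * (-y) - ((1 / α : ℝ) : EReal) * (L : EReal) ≤ -x := by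
  have hneg := EReal.neg_le_neg_iff.2 h
  rw [EReal.neg_add (Or.inr (EReal.coe_ne_top _)) (Or.inr (EReal.coe_ne_bot _))] at hneg
  rwa [mul_neg, ← EReal.coe_mul]

end Limits

/-! ### Single-letter Rényi moments and Hölder's change of measure -/

/-- The mass function of a Bernoulli variable with parameter `p`. -/
noncomputable def bernoulliMass (p : ℝ) (z : ZMod 2) : ℝ := if z = 1 then p else 1 - p

lemma bernoulliMass_pos {p : ℝ} (h0 : 0 < p) (h1 : p < 1) (z : ZMod 2) : 0 < bernoulliMass p z := by
  unfold bernoulliMass; split_ifs <;> linarith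

lemma sum_bernoulliMass_sub (p : ℝ) (s : ZMod 2) : ∑ y, bernoulliMass p (y - s) = 1 := by
  rw [show ∑ y, bernoulliMass p (y - s) = ∑ y, bernoulliMass p y from
    (Equiv.subRight s).sum_comp (bernoulliMass p), show (Finset.univ : Finset (ZMod 2)) = {0, 1}
    from rfl]
  simp [bernoulliMass]

/-- Different shifts exchange the masses `p` and `1 - p`, which produces the two terms of δ(α). -/
lemma sum_bernoulliMass_rpow_eq {p : ℝ} (h0 : 0 < p) (h1 : p < 1) (α : ℝ) (s t : ZMod 2) :
    ∑ y, bernoulliMass p (y - s) ^ α * bernoulliMass p (y - t) ^ (1 - α)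
      = if s = t then 1 else erasureDelta p α := by
  split_ifs with hst
  · subst hst
    refine Eq.trans ?_ (sum_bernoulliMass_sub p s)
    refine Finset.sum_congr rfl fun y _ => ?_
    rw [← Real.rpow_add (bernoulliMass_pos h0 h1 _)]
    simp
  · have hq : 0 < 1 - p := by linarith
    have e1 : p * ((1 - p) / p) ^ α = (1 - p) ^ α * p ^ (1 - α) := by
      rw [Real.div_rpow hq.le h0.le, Real.rpow_sub h0, Real.rpow_one]
      field_simp
    have e2 : (1 - p) * (p / (1 - p)) ^ α = p ^ α * (1 - p) ^ (1 - α) := by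
      rw [Real.div_rpow h0.le hq.le, Real.rpow_sub hq, Real.rpow_one]
      field_simp
    rw [erasureDelta, e1, e2, show (Finset.univ : Finset (ZMod 2)) = {0, 1} from rfl]
    rw [Finset.sum_pair (by decide)]
    have h01 : (0 : ZMod 2) - 1 = 1 := by decide
    have hz : ∀ z : ZMod 2, z = 0 ∨ z = 1 := by decide
    rcases hz s with rfl | rfl <;> rcases hz t with rfl | rfl
    · exact absurd rfl hst
    · simp [bernoulliMass, h01]
    · simp [bernoulliMass, h01, add_comm]
    · exact absurd rfl hst

/-- Hölder's inequality for the change of measure from `g` to `f` on a finite set. -/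
lemma sum_le_rpow_mul_rpow_of_one_lt {ι : Type*} [Fintype ι] (S : Finset ι) {f g : ι → ℝ}
    (hf : ∀ i, 0 ≤ f i) (hg : ∀ i, 0 ≤ g i) (hfg : ∀ i, f i = 0 → g i = 0) {α : ℝ} (hα : 1 < α) :
    ∑ i ∈ S, g i
      ≤ (∑ i ∈ S, f i) ^ ((α - 1) / α) * (∑ i, g i ^ α * f i ^ (1 - α)) ^ (1 / α) := by
  have h0 : 0 < α := by linarith
  have h1 : 0 < α - 1 := by linarith
  have hn : ∀ i, 0 ≤ g i ^ α * f i ^ (1 - α) := fun i =>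
    mul_nonneg (Real.rpow_nonneg (hg i) _) (Real.rpow_nonneg (hf i) _)
  calc ∑ i ∈ S, g i ≤ ∑ i ∈ S, f i ^ ((α - 1) / α) * (g i ^ α * f i ^ (1 - α)) ^ (1 / α) := by
        refine Finset.sum_le_sum fun i _ => ?_
        rcases (hf i).eq_or_lt with h | h
        · rw [hfg i h.symm]
          exact mul_nonneg (Real.rpow_nonneg (hf i) _)
            (Real.rpow_nonneg (mul_nonneg (by positivity) (Real.rpow_nonneg (hf i) _)) _)
        -- The powers of `f i` cancel, since (α-1)/α + (1-α)/α = 0.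
        · rw [Real.mul_rpow (Real.rpow_nonneg (hg i) _) (Real.rpow_nonneg h.le _),
            ← Real.rpow_mul (hg i), ← Real.rpow_mul h.le, mul_left_comm, ← Real.rpow_add h,
            mul_one_div_cancel h0.ne', Real.rpow_one,
            show (α - 1) / α + (1 - α) * (1 / α) = 0 by field_simp; ring, Real.rpow_zero, mul_one]
    _ ≤ (∑ i ∈ S, f i) ^ ((α - 1) / α) * (∑ i ∈ S, g i ^ α * f i ^ (1 - α)) ^ (1 / α) :=
        sum_rpow_mul_rpow_le S (fun i _ => hf i) (fun i _ => hn i) (by positivity) (by positivity)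
          (by field_simp; ring)
    _ ≤ _ := by
        refine mul_le_mul_of_nonneg_left ?_ (Real.rpow_nonneg (Finset.sum_nonneg fun i _ => hf i) _)
        exact Real.rpow_le_rpow (Finset.sum_nonneg fun i _ => hn i)
          (Finset.sum_le_univ_sum_of_nonneg hn) (by positivity)

/-- The change of measure between the two shifted noise laws, applied to the whole space, reads 1 ≤
δ(α)^(1/α). -/
lemma one_le_erasureDelta {p : ℝ} (h0 : 0 < p) (h1 : p < 1) {α : ℝ} (hα : 1 < α) :
    1 ≤ erasureDelta p α := by
  have hb := bernoulliMass_pos h0 h1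
  have h := sum_le_rpow_mul_rpow_of_one_lt (Finset.univ : Finset (ZMod 2))
    (f := fun y => bernoulliMass p (y - 0)) (g := fun y => bernoulliMass p (y - 1))
    (fun y => (hb _).le) (fun y => (hb _).le) (fun y hy => absurd hy (hb _).ne') hα
  rw [sum_bernoulliMass_sub, sum_bernoulliMass_sub, sum_bernoulliMass_rpow_eq h0 h1,
    if_neg (by decide), Real.one_rpow, one_mul] at h
  by_contra! hlt
  have hpos : 0 ≤ erasureDelta p α := by
    have : 0 < 1 - p := by linarith
    unfold erasureDelta; positivity
  exact absurd h (not_le.2 (Real.rpow_lt_one hpos hlt (by positivity)))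

/-! ### Law of a noise word -/

section Noise

variable {Ω : Type*} [MeasurableSpace Ω] {P : Measure Ω} {p : ℝ} {N : ℕ → Ω → ZMod 2}

lemma IsBernoulliNoise.measureReal_eq [IsProbabilityMeasure P] (hN : IsBernoulliNoise P p N)
    (t : ℕ) (z : ZMod 2) : P.real (N t ⁻¹' {z}) = bernoulliMass p z := by
  have h1 : P.real (N t ⁻¹' {1}) = p := hN.prob_one t
  have hz : z = 0 ∨ z = 1 := by revert z; decide
  rcases hz with rfl | rfl
  · have hc : N t ⁻¹' {0} = (N t ⁻¹' {1})ᶜ := by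
      ext ω
      simp only [Set.mem_preimage, Set.mem_singleton_iff, Set.mem_compl_iff]
      generalize N t ω = z
      revert z; decide
    rw [hc, probReal_compl_eq_one_sub (hN.measurable t (Set.toFinite _).measurableSet), h1]
    simp [bernoulliMass]
  · simpa [bernoulliMass] using h1

lemma IsBernoulliNoise.measureReal_word [IsProbabilityMeasure P] (hN : IsBernoulliNoise P p N)
    (n : ℕ) (v : Word n) :
    P.real ((fun ω (t : Fin n) => N t ω) ⁻¹' {v}) = ∏ t, bernoulliMass p (v t) := by
  have h := (hN.indep.precomp (Fin.val_injective (n := n))).measure_inter_preimage_eq_mul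
    Finset.univ (sets := fun t => {v t}) (fun t _ => (Set.toFinite _).measurableSet)
  have hs : (fun ω (t : Fin n) => N t ω) ⁻¹' {v}
      = ⋂ t ∈ (Finset.univ : Finset (Fin n)), N t ⁻¹' {v t} := by
    ext ω
    simp [funext_iff]
  rw [hs, measureReal_def, h, ENNReal.toReal_prod]
  exact Finset.prod_congr rfl fun t _ => hN.measureReal_eq t (v t)

end Noise

/-! ### Masked channels and their Rényi moment -/

section Channel

variable {Ω : Type*} [MeasurableSpace Ω] {P : Measure Ω} {p : ℝ} {d : ℕ}
  {PI : Matrix (Fin d) (Fin d) ℝ} {f : Fin d → ZMod 2} {M : ℕ → ℕ}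
  {cb : ∀ n, Ω → Codebook (M n) n} {msg : ∀ n, Ω → Fin (M n)}
  {A : ℕ → Ω → Fin d} {N : ℕ → Ω → ZMod 2} {Y : ∀ n, Ω → Word n}

/-- The mass which input, chain and output have in block `n`, when the channel multiplies the
input by the factor `e (A t)` before it adds the noise. -/
noncomputable def channelMass (P : Measure Ω) (p : ℝ) (cb : ∀ n, Ω → Codebook (M n) n)
    (msg : ∀ n, Ω → Fin (M n)) (A : ℕ → Ω → Fin d) (n : ℕ) (e : Fin d → ZMod 2)
    (x : (Codebook (M n) n × Fin (M n)) × (Fin n → Fin d) × Word n) : ℝ :=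
  P.real ((fun ω => (cb n ω, msg n ω)) ⁻¹' {x.1}) * P.real {ω | ∀ t : Fin n, A t ω = x.2.1 t}
    * ∏ t, bernoulliMass p (x.2.2 t - e (x.2.1 t) * x.1.1 x.1.2 t)

/-- The output of the channel which multiplies the input by `e (A t)`. -/
def maskedOutput (cb : ∀ n, Ω → Codebook (M n) n) (msg : ∀ n, Ω → Fin (M n))
    (A : ℕ → Ω → Fin d) (N : ℕ → Ω → ZMod 2) (e : Fin d → ZMod 2) (n : ℕ) (ω : Ω) : Word n :=
  fun t => e (A t ω) * codeword cb msg n ω t + N t ω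

lemma IsErasureChannel.measureReal_joint [IsProbabilityMeasure P]
    (hP : IsErasureChannel P p PI f cb msg A N Y) (n : ℕ) (z : Codebook (M n) n × Fin (M n))
    (i : Fin n → Fin d) (v : Word n) :
    P.real ((fun ω => ((cb n ω, msg n ω), (fun t : Fin n => A t ω), fun t : Fin n => N t ω)) ⁻¹'
        {(z, i, v)})
      = P.real ((fun ω => (cb n ω, msg n ω)) ⁻¹' {z}) * P.real {ω | ∀ t : Fin n, A t ω = i t}
        * ∏ t, bernoulliMass p (v t) := by
  have hm : Measurable fun (a : ℕ → Fin d) (t : Fin n) => a t := by fun_prop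
  have hm' : Measurable fun (a : ℕ → ZMod 2) (t : Fin n) => a t := by fun_prop
  have h1 := (hP.indep_input n).comp (φ := id)
    (ψ := fun q : (ℕ → Fin d) × (ℕ → ZMod 2) => ((fun t : Fin n => q.1 t), fun t : Fin n => q.2 t))
    measurable_id (by fun_prop)
  have h2 := hP.indep_chain_noise.comp hm hm'
  have e1 := h1.measure_inter_preimage_eq_mul {z} {(i, v)} (Set.toFinite _).measurableSet
    (Set.toFinite _).measurableSet
  have e2 := h2.measure_inter_preimage_eq_mul {i} {v} (Set.toFinite _).measurableSet
    (Set.toFinite _).measurableSet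
  have s1 : (fun ω => ((cb n ω, msg n ω), (fun t : Fin n => A t ω), fun t : Fin n => N t ω)) ⁻¹'
      {(z, i, v)} = (id ∘ fun ω => (cb n ω, msg n ω)) ⁻¹' {z} ∩
        ((fun q : (ℕ → Fin d) × (ℕ → ZMod 2) => ((fun t : Fin n => q.1 t), fun t : Fin n => q.2 t))
          ∘ fun ω => ((fun t => A t ω), (fun t => N t ω))) ⁻¹' {(i, v)} := by
    ext ω; simp
  have s2 : ((fun q : (ℕ → Fin d) × (ℕ → ZMod 2) => ((fun t : Fin n => q.1 t), fun t : Fin n => q.2 t))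
          ∘ fun ω => ((fun t => A t ω), (fun t => N t ω))) ⁻¹' {(i, v)}
      = ((fun (a : ℕ → Fin d) (t : Fin n) => a t) ∘ fun ω t => A t ω) ⁻¹' {i} ∩
        ((fun (a : ℕ → ZMod 2) (t : Fin n) => a t) ∘ fun ω t => N t ω) ⁻¹' {v} := by
    ext ω; simp
  have s3 : ((fun (a : ℕ → Fin d) (t : Fin n) => a t) ∘ fun ω t => A t ω) ⁻¹' {i}
      = {ω | ∀ t : Fin n, A t ω = i t} := by
    ext ω; simp [funext_iff]
  rw [s1, measureReal_def, e1, s2, e2, ENNReal.toReal_mul, ENNReal.toReal_mul, ← mul_assoc, s3,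
    ← hP.noise.measureReal_word n v]
  rfl

lemma IsErasureChannel.measurable_joint
    (hP : IsErasureChannel P p PI f cb msg A N Y) (n : ℕ) :
    Measurable fun ω => ((cb n ω, msg n ω), (fun t : Fin n => A t ω), fun t : Fin n => N t ω) := by
  have h1 := hP.measurable_cb n
  have h2 := hP.measurable_msg n
  have h3 := hP.chain.measurable
  have h4 := hP.noise.measurable
  exact (h1.prodMk h2).prodMk ((measurable_pi_lambda _ fun t : Fin n => h3 t).prodMk
    (measurable_pi_lambda _ fun t : Fin n => h4 t))

open scoped Classical in
lemma IsErasureChannel.measureReal_maskedOutput [IsProbabilityMeasure P]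
    (hP : IsErasureChannel P p PI f cb msg A N Y) (n : ℕ) (e : Fin d → ZMod 2)
    (S : Set ((Codebook (M n) n × Fin (M n)) × Word n)) :
    P.real {ω | ((cb n ω, msg n ω), maskedOutput cb msg A N e n ω) ∈ S}
      = ∑ x with (x.1, x.2.2) ∈ S, channelMass P p cb msg A n e x := by
  set X := fun ω => ((cb n ω, msg n ω), (fun t : Fin n => A t ω),
    maskedOutput cb msg A N e n ω) with hX
  -- Given input and path, the output determines the noise, so the joint law of the independent
  -- sources applies.
  have hpre : ∀ x, X ⁻¹' {x} = (fun ω => ((cb n ω, msg n ω), (fun t : Fin n => A t ω),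
      fun t : Fin n => N t ω)) ⁻¹'
        {(x.1, x.2.1, fun t => x.2.2 t - e (x.2.1 t) * x.1.1 x.1.2 t)} := by
    rintro ⟨⟨c, m⟩, i, y⟩
    ext ω
    simp only [hX, Set.mem_preimage, Set.mem_singleton_iff, Prod.mk.injEq]
    refine and_congr_right fun hz => and_congr_right fun hi => ?_
    obtain ⟨rfl, rfl⟩ := hz
    subst hi
    simp only [funext_iff, maskedOutput, codeword]
    exact forall_congr' fun t => by rw [eq_sub_iff_add_eq, add_comm]
  have h := sum_measureReal_preimage_singleton (μ := P)
    (Finset.univ.filter fun x => (x.1, x.2.2) ∈ S) (f := X) (fun x _ => by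
      rw [hpre]; exact hP.measurable_joint n (Set.toFinite _).measurableSet)
  rw [show {ω | ((cb n ω, msg n ω), maskedOutput cb msg A N e n ω) ∈ S}
      = X ⁻¹' (Finset.univ.filter fun x : (Codebook (M n) n × Fin (M n)) × (Fin n → Fin d) × Word n
        => (x.1, x.2.2) ∈ S : Finset _) by ext ω; simp [hX], ← h]
  refine Finset.sum_congr rfl fun x _ => ?_
  rw [hpre, hP.measureReal_joint]
  rfl

lemma channelMass_nonneg (h0 : 0 < p) (h1 : p < 1) (n : ℕ) (e : Fin d → ZMod 2)
    (x : (Codebook (M n) n × Fin (M n)) × (Fin n → Fin d) × Word n) :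
    0 ≤ channelMass P p cb msg A n e x :=
  mul_nonneg (mul_nonneg measureReal_nonneg measureReal_nonneg)
    (Finset.prod_nonneg fun _ _ => (bernoulliMass_pos h0 h1 _).le)

/-- Absolute continuity: noise masses are positive, so only the mask-independent law of input and
path can vanish. -/
lemma channelMass_eq_zero (h0 : 0 < p) (h1 : p < 1) (n : ℕ) (e e' : Fin d → ZMod 2)
    (x : (Codebook (M n) n × Fin (M n)) × (Fin n → Fin d) × Word n)
    (h : channelMass P p cb msg A n e x = 0) : channelMass P p cb msg A n e' x = 0 := by
  unfold channelMass at h ⊢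
  rcases mul_eq_zero.1 h with h | h
  · rw [h, zero_mul]
  · exact absurd h (Finset.prod_pos fun _ _ => bernoulliMass_pos h0 h1 _).ne'

lemma IsErasureChannel.sum_input_eq_one [IsProbabilityMeasure P]
    (hP : IsErasureChannel P p PI f cb msg A N Y) (n : ℕ) :
    ∑ z, P.real ((fun ω => (cb n ω, msg n ω)) ⁻¹' {z}) = 1 := by
  rw [sum_measureReal_preimage_singleton Finset.univ fun z _ =>
    ((hP.measurable_cb n).prodMk (hP.measurable_msg n)) (Set.toFinite _).measurableSet]
  simp

/-- The Rényi moment of one masked channel with respect to another is at most the moment of the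
number of erasures. -/
lemma IsErasureChannel.sum_channelMass_rpow_le [IsProbabilityMeasure P]
    (hP : IsErasureChannel P p PI f cb msg A N Y) (h0 : 0 < p) (h1 : p < 1) {α : ℝ} (hα : 1 < α)
    (n : ℕ) {e e' : Fin d → ZMod 2} (hee : ∀ j, f j ≠ 0 → e j = e' j) :
    ∑ x, channelMass P p cb msg A n e' x ^ α * channelMass P p cb msg A n e x ^ (1 - α)
      ≤ ∑ i : Fin n → Fin d, P.real {ω | ∀ t : Fin n, A t ω = i t}
        * ∏ t, Real.exp (Real.log (erasureDelta p α) * (if f (i t) = 0 then 1 else 0)) := by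
  have hδ := one_le_erasureDelta h0 h1 hα
  have hb := bernoulliMass_pos h0 h1
  -- The exponents α and 1 - α add up to 1, so the common law of input and path appears to the first
  -- power.
  have hterm : ∀ x : (Codebook (M n) n × Fin (M n)) × (Fin n → Fin d) × Word n,
      channelMass P p cb msg A n e' x ^ α * channelMass P p cb msg A n e x ^ (1 - α)
      = P.real ((fun ω => (cb n ω, msg n ω)) ⁻¹' {x.1}) *
        (P.real {ω | ∀ t : Fin n, A t ω = x.2.1 t} *
        ∏ t, bernoulliMass p (x.2.2 t - e' (x.2.1 t) * x.1.1 x.1.2 t) ^ α *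
          bernoulliMass p (x.2.2 t - e (x.2.1 t) * x.1.1 x.1.2 t) ^ (1 - α)) := by
    intro x
    unfold channelMass
    rw [Finset.prod_mul_distrib, Real.finsetProd_rpow _ _ fun _ _ => (hb _).le,
      Real.finsetProd_rpow _ _ fun _ _ => (hb _).le, ← mul_assoc]
    have hw : 0 ≤ P.real ((fun ω => (cb n ω, msg n ω)) ⁻¹' {x.1}) *
      P.real {ω | ∀ t : Fin n, A t ω = x.2.1 t} := mul_nonneg measureReal_nonneg measureReal_nonneg
    rw [Real.mul_rpow hw (Finset.prod_nonneg fun _ _ => (hb _).le),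
      Real.mul_rpow hw (Finset.prod_nonneg fun _ _ => (hb _).le), mul_mul_mul_comm,
      ← Real.rpow_add' hw (by simp)]
    simp
  -- At an erased letter the moment is 1 or δ(α), according to whether the masked inputs agree. Both
  -- are at most δ(α).
  have hfac : ∀ (j : Fin d) (s : ZMod 2),
      ∑ y, bernoulliMass p (y - e' j * s) ^ α * bernoulliMass p (y - e j * s) ^ (1 - α)
        ≤ Real.exp (Real.log (erasureDelta p α) * (if f j = 0 then 1 else 0)) := by
    intro j s
    rw [sum_bernoulliMass_rpow_eq h0 h1]
    by_cases hj : f j = 0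
    · rw [if_pos hj, mul_one, Real.exp_log (by linarith)]
      split_ifs <;> linarith
    · simp [hj, hee j hj]
  have hprod : ∀ (z : Codebook (M n) n × Fin (M n)) (i : Fin n → Fin d),
      ∑ y : Word n, ∏ t, bernoulliMass p (y t - e' (i t) * z.1 z.2 t) ^ α *
          bernoulliMass p (y t - e (i t) * z.1 z.2 t) ^ (1 - α)
        ≤ ∏ t, Real.exp (Real.log (erasureDelta p α) * (if f (i t) = 0 then 1 else 0)) := by
    intro z i
    have hswap := Finset.prod_univ_sum (fun _ : Fin n => (Finset.univ : Finset (ZMod 2)))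
      fun t y => bernoulliMass p (y - e' (i t) * z.1 z.2 t) ^ α *
          bernoulliMass p (y - e (i t) * z.1 z.2 t) ^ (1 - α)
    rw [Fintype.piFinset_univ] at hswap
    rw [← hswap]
    refine Finset.prod_le_prod (fun t _ => Finset.sum_nonneg fun y _ => ?_) fun t _ => hfac _ _
    exact mul_nonneg (Real.rpow_nonneg (hb _).le _) (Real.rpow_nonneg (hb _).le _)
  simp only [hterm]
  rw [Fintype.sum_prod_type]
  simp only [Fintype.sum_prod_type (α₁ := Fin n → Fin d), ← Finset.mul_sum]
  refine (Finset.sum_le_sum fun z _ => mul_le_mul_of_nonneg_left (Finset.sum_le_sum fun i _ =>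
    mul_le_mul_of_nonneg_left (hprod z i) measureReal_nonneg) measureReal_nonneg).trans ?_
  rw [← Finset.sum_mul, hP.sum_input_eq_one, one_mul]

end Channel

/-- The logarithm is taken in `EReal`, which admits zero probabilities. -/
lemma log_le_mul_log_add {x y : ℝ≥0∞} (hx : x ≠ ∞) (hy : y ≠ ∞) {β γ K : ℝ} (hβ : 0 ≤ β)
    (hK : 0 < K) (h : x.toReal ≤ y.toReal ^ β * K ^ γ) (n : ℕ) :
    ((1 / (n : ℝ) : ℝ) : EReal) * ENNReal.log x
      ≤ (β : EReal) * (((1 / (n : ℝ) : ℝ) : EReal) * ENNReal.log y)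
        + ((γ * (1 / (n : ℝ) * Real.log K) : ℝ) : EReal) := by
  have hle : x ≤ y ^ β * ENNReal.ofReal (K ^ γ) := by
    rw [← ENNReal.ofReal_toReal hx, ← ENNReal.ofReal_toReal hy,
      ENNReal.ofReal_rpow_of_nonneg ENNReal.toReal_nonneg hβ, ← ENNReal.ofReal_mul (by positivity)]
    exact ENNReal.ofReal_le_ofReal h
  have hlog := ENNReal.log_le_log hle
  rw [ENNReal.log_mul_add, ENNReal.log_rpow,
    ENNReal.log_ofReal_of_pos (Real.rpow_pos_of_pos hK γ), Real.log_rpow hK] at hlog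
  have hn : (0 : EReal) ≤ ((1 / (n : ℝ) : ℝ) : EReal) := EReal.coe_nonneg.2 (by positivity)
  refine (mul_le_mul_of_nonneg_left hlog hn).trans_eq ?_
  rw [EReal.left_distrib_of_nonneg_of_ne_top hn (EReal.coe_ne_top _), ← EReal.coe_mul,
    mul_left_comm, mul_left_comm (1 / (n : ℝ))]

/-! ### Comparison of the error probabilities -/

section Channel

variable {Ω : Type*} [MeasurableSpace Ω] {P Q : Measure Ω} {p : ℝ} {d : ℕ}
  {PI : Matrix (Fin d) (Fin d) ℝ} {f : Fin d → ZMod 2} {M : ℕ → ℕ}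
  {cb : ∀ n, Ω → Codebook (M n) n} {msg : ∀ n, Ω → Fin (M n)}
  {A : ℕ → Ω → Fin d} {N N' : ℕ → Ω → ZMod 2} {Y : ∀ n, Ω → Word n}
  {ψ : ∀ n, Codebook (M n) n → Word n → Fin (M n)}

/-- The masks are only required to agree off the erasures, a symmetric condition, so exchanging them
yields both bounds of the theorem. -/
lemma IsErasureChannel.measureReal_maskedOutput_le [IsProbabilityMeasure P]
    (hP : IsErasureChannel P p PI f cb msg A N Y) (hPI : ∀ i j, 0 ≤ PI i j)
    (h0 : 0 < p) (h1 : p < 1) {α : ℝ} (hα : 1 < α) {n : ℕ} (hn : 0 < n)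
    {e e' : Fin d → ZMod 2} (hee : ∀ j, f j ≠ 0 → e j = e' j)
    (S : Set ((Codebook (M n) n × Fin (M n)) × Word n)) :
    P.real {ω | ((cb n ω, msg n ω), maskedOutput cb msg A N e' n ω) ∈ S}
      ≤ P.real {ω | ((cb n ω, msg n ω), maskedOutput cb msg A N e n ω) ∈ S} ^ ((α - 1) / α)
        * (Real.exp |Real.log (erasureDelta p α)| *
          powEntrySum (tiltedMatrix PI f (Real.log (erasureDelta p α))) (n - 1)) ^ (1 / α) := by
  classical
  obtain ⟨n, rfl⟩ : ∃ k, n = k + 1 := ⟨n - 1, by omega⟩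
  rw [hP.measureReal_maskedOutput, hP.measureReal_maskedOutput]
  refine (sum_le_rpow_mul_rpow_of_one_lt _ (channelMass_nonneg h0 h1 _ e)
    (channelMass_nonneg h0 h1 _ e') (channelMass_eq_zero h0 h1 _ e e') hα).trans ?_
  refine mul_le_mul_of_nonneg_left ?_ (Real.rpow_nonneg
    (Finset.sum_nonneg fun x _ => channelMass_nonneg h0 h1 _ e x) _)
  refine Real.rpow_le_rpow (Finset.sum_nonneg fun x _ => mul_nonneg
    (Real.rpow_nonneg (channelMass_nonneg h0 h1 _ e' x) _)
    (Real.rpow_nonneg (channelMass_nonneg h0 h1 _ e x) _)) ?_ (by positivity)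
  exact (hP.sum_channelMass_rpow_le h0 h1 hα _ hee).trans (hP.chain.sum_path_le hPI f _ n)

lemma IsErasureChannel.measure_errorEvent (hP : IsErasureChannel P p PI f cb msg A N Y) (n : ℕ) :
    P (errorEvent ψ cb msg Y n)
      = P {ω | ((cb n ω, msg n ω), maskedOutput cb msg A N f n ω) ∈
          {x : (Codebook (M n) n × Fin (M n)) × Word n | ψ n x.1.1 x.2 ≠ x.1.2}} := by
  refine measure_congr ?_
  filter_upwards [hP.output n] with ω hω
  have : Y n ω = maskedOutput cb msg A N f n ω := funext hω
  apply propext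
  change ψ n (cb n ω) (Y n ω) ≠ msg n ω ↔ _
  rw [this]
  rfl

/-- Equality of the joint laws removes `Q`: what remains is the channel with mask 1 under `P`. -/
lemma IsReferenceChannel.measure_errorEvent (hQ : IsReferenceChannel P Q f cb msg A N N' Y)
    (n : ℕ) :
    Q (errorEvent ψ cb msg Y n)
      = P {ω | ((cb n ω, msg n ω), maskedOutput cb msg A N 1 n ω) ∈
          {x : (Codebook (M n) n × Fin (M n)) × Word n | ψ n x.1.1 x.2 ≠ x.1.2}} := by
  have h := (hQ.same_law n).measure_mem_eq
    (s := {x | ψ n x.1.1 (fun t => x.1.1 x.1.2 t + x.2.2 t) ≠ x.1.2})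
    (Set.toFinite _).measurableSet
  refine Eq.trans (b := Q _) ?_ (h.trans (congrArg P ?_))
  · refine measure_congr ?_
    filter_upwards [hQ.output n] with ω hω
    have : Y n ω = fun t => codeword cb msg n ω t + N' t ω := funext hω
    apply propext
    change ψ n (cb n ω) (Y n ω) ≠ msg n ω ↔ _
    rw [this]
    rfl
  · ext ω
    have : maskedOutput cb msg A N 1 n ω = fun t => cb n ω (msg n ω) t + N t ω := by
      funext t
      simp [maskedOutput, codeword]
    simp [this]

end Channel

theorem mainTheorem4 {Ω : Type*} [MeasurableSpace Ω]
    (P Q : Measure Ω) [IsProbabilityMeasure P] [IsProbabilityMeasure Q]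
    (p : ℝ) (hp_pos : 0 < p) (hp_half : p ≤ 1 / 2)
    {d : ℕ} (PI : Matrix (Fin d) (Fin d) ℝ) (hPI_sum : ∀ i, ∑ j, PI i j = 1)
    (hPI_irr : PI.IsIrreducible) (f : Fin d → ZMod 2)
    (M : ℕ → ℕ) (cb : ∀ n, Ω → Codebook (M n) n) (msg : ∀ n, Ω → Fin (M n))
    (A : ℕ → Ω → Fin d) (N N' : ℕ → Ω → ZMod 2) (Y : ∀ n, Ω → Word n)
    (hP : IsErasureChannel P p PI f cb msg A N Y)
    (hQ : IsReferenceChannel P Q f cb msg A N N' Y)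
    (dm : ZMod 2 → ZMod 2 → ℝ) (hdm : ∀ x y, 0 ≤ dm x y)
    (ψ : ∀ n, Codebook (M n) n → Word n → Fin (M n))
    (hψ : ∀ n, IsMetricDecoder dm (ψ n))
    (α : ℝ) (hα : 1 < α) :
    upperExponent P (errorEvent ψ cb msg Y)
        ≤ ((α / (α - 1) : ℝ) : EReal) * upperExponent Q (errorEvent ψ cb msg Y)
          + ((1 / (α - 1) : ℝ) : EReal) * divergenceRate p PI f α ∧
    (((α - 1) / α : ℝ) : EReal) * lowerExponent Q (errorEvent ψ cb msg Y)
          - ((1 / α : ℝ) : EReal) * divergenceRate p PI f α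
        ≤ lowerExponent P (errorEvent ψ cb msg Y) := by
  have hp1 : p < 1 := by linarith
  have hα0 : 0 < α := by linarith
  have hβ : 0 < (α - 1) / α := div_pos (by linarith) hα0
  have hd : 0 < d := by
    obtain ⟨ω⟩ := nonempty_of_isProbabilityMeasure P
    exact Fin.pos (A 0 ω)
  rw [divergenceRate_eq hd hPI_irr.nonneg hPI_sum]
  set l := Real.log (erasureDelta p α)
  have hS := powEntrySum_tiltedMatrix_pos (f := f) hd hPI_irr.nonneg hPI_sum l
  have hlim := (tendsto_log_mul_shift hS (Real.exp_pos |l|)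
    (tendsto_log_powEntrySum_tiltedMatrix hd hPI_irr.nonneg hPI_sum l)).const_mul (1 / α)
  have hK : ∀ n, 0 < Real.exp |l| * powEntrySum (tiltedMatrix PI f l) n := fun n =>
    mul_pos (Real.exp_pos _) (hS n)
  have hf1 : ∀ j, f j ≠ 0 → f j = (1 : Fin d → ZMod 2) j := fun j hj => by
    rw [Pi.one_apply]
    revert hj
    generalize f j = z
    revert z; decide
  constructor
  -- Here the error probability under `Q` is bounded by a power of the one under `P`; the second
  -- half exchanges the roles.
  · refine neg_le_of_le_mul_add hα (liminf_le_mul_liminf_add hβ hlim ?_)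
    filter_upwards [eventually_gt_atTop 0] with n hn
    refine log_le_mul_log_add (measure_ne_top _ _) (measure_ne_top _ _) hβ.le (hK _) ?_ n
    rw [hP.measure_errorEvent, hQ.measure_errorEvent]
    exact hP.measureReal_maskedOutput_le hPI_irr.nonneg hp_pos hp1 hα hn hf1 _
  · refine mul_neg_sub_le_neg (limsup_le_mul_limsup_add hβ hlim ?_)
    filter_upwards [eventually_gt_atTop 0] with n hn
    refine log_le_mul_log_add (measure_ne_top _ _) (measure_ne_top _ _) hβ.le (hK _) ?_ n
    rw [hP.measure_errorEvent, hQ.measure_errorEvent]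
    exact hP.measureReal_maskedOutput_le hPI_irr.nonneg hp_pos hp1 hα hn
      (fun j hj => (hf1 j hj).symm) _
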